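/- **Diagrams.** Write $\mathbf 1=\{0\}$, $\mathbf 2=\{0,1\}$, and $\mathbf 2^X$ for the power set of $X$. A map $f:X\to Y$ has a power map $f:\mathbf 2^X\to\mathbf 2^Y$, $f(A)=\{f(x)\mid x\in A\}$, and an inverse map $f^{-1}:\mathbf 2^Y\to\mathbf 2^X$, $f^{-1}(A)=\{x\mid f(x)\in A\}$. A *diagram* $(\mathscr S,\mathscr S',\mathscr M)$ is a family $\mathscr S$ of sets (members with different indices are distinguished even if they are equal as sets), a subfamily $\mathscr S'$, and a family $\mathscr M$ of maps $\varphi:\mathbf 2^{S}\to\mathbf 2^{T}$ with $S=\mathrm{dm}(\varphi)$, $T=\mathrm{cdm}(\varphi)$ in $\mathscr S$; let $\mathrm{in}(T)=\{\varphi\mid \mathrm{cdm}(\varphi)=T\}$. A *cross section* of the diagram assigns to every $S\in\mathscr S$ a subset $s(S)\subset S$ such that, whenever $\mathrm{in}(S)\ne\emptyset$, $s(S)=\bigcap_{\varphi\in\mathrm{in}(S)}\varphi(s(\mathrm{dm}(\varphi)))$ if $S\notin\mathscr S'$, and $s(S)=\bigcup_{\varphi\in\mathrm{in}(S)}\varphi(s(\mathrm{dm}(\varphi)))$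 if $S\in\mathscr S'$. **Sizes.** For a set $\mathcal M$ of maps, $\langle\mathcal M\rangle$ is the smallest class of maps that contains $\mathcal M$, all identities, all maps $\omega:X\to\mathbf 1$ and all projections $\pi_i:X_1\times\cdots\times X_n\to X_i$, and is closed under composition and under products $f_1\times\cdots\times f_n:X\to Y_1\times\cdots\times Y_n$, $x\mapsto(f_1(x),\dots,f_n(x))$, of maps $f_i:X\to Y_i$ ($n\ge1$). The size $|f|_{\mathcal M}$ of $f\in\langle\mathcal M\rangle$ is the least cost of building $f$ in this way, where each of the basic maps costs $1$, and a composition or a product costs $1$ plus the sum of the costs of its components. A diagram is *generated by* $\mathcal M$ if each $\varphi\in\mathscr M$ is the power map or the inverse map of some $f\in\langle\mathcal M\rangle$; then $|\varphi|_{\mathcal M}$ is the (least) size of such an $f$. **Structural information.** For a subset $A$ of a set $X$, $I(A\mid\mathcal M)\in\mathbb N\cup\{\infty\}$ is the minimum of $\sum_{\varphi\in\mathscr M}|\varphi|_{\mathcal M}$ over all diagrams generated by $\mathcal M$ with a chosen member $\mathbf 1$ and a chosen member $X$ of $\mathscr S$ such that there is at least one cross section $s$ of the diagram with $s(\mathbf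 1)=\mathbf 1$, and every such cross section satisfies $s(X)=A$; it is $\infty$ if there is no such diagram with a finite sum. **Strings and machines.** Let $\mathcal M_{\mathbb N}=\{0,\mathrm{succ}\}$, where $0:\mathbf 1\to\mathbb N$ is the constant map and $\mathrm{succ}:\mathbb N\to\mathbb N$ is the successor map. A binary string $\sigma\in\mathbf 2^*$ is encoded as $$\bar\sigma=\{(i,\sigma[i])\mid 0\le i<|\sigma|\}\cup\{(|\sigma|,0),(|\sigma|,1)\}\subset\mathbb N\times\mathbb N .$$ A Turing machine $M$ here is deterministic with input alphabet $\mathbf 2$, a finite tape alphabet containing $\mathbf 2$ and a blank, one tape that is infinite to the right, and distinct accept and reject states. Write $M(p)=\tau$ if $M$, on input $p\in\mathbf 2^*$, accepts leaving the string $\tau\in\mathbf 2^*$ (followed only by blanks) on its tape; otherwise $M(p)$ is undefined. $U$ is *universal* if for every Turing machine $M$ there is a computable $e_M:\mathbf 2^*\to\mathbf 2^*$ with $U(e_M(p))=M(p)$ for all $p$ (both sides defined with equal values, or both undefined). The Kolmogorov complexity is $K_U(\sigma)=\min\{|p| : p\in\mathbf 2^*,\ U(p)=\sigma\}$. **Theorem.**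 For any universal Turing machine $U$ there is a constant $c_U\in\mathbb N$ such that, for every binary string $\sigma\in\mathbf 2^*$, $$I(\bar\sigma\mid\mathcal M_{\mathbb N})\le 6\,K_U(\sigma)+c_U .$$ -/

import Mathlib

/-! ### Turing machines with binary input alphabet -/

/-- A deterministic one-tape Turing machine `(Q, 𝟐, Θ, ␣, δ, q₀, q_A, q_R)` with input alphabet
`𝟐 = {0, 1}` (`false` is `0`, `true` is `1`). The tape is infinite to the right only. In the third
component of `δ`, `true` moves the head to the right and `false` moves it to the left. -/
structure TuringMachine where
  /-- the states -/
  Q : Type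
  /-- the tape symbols -/
  Θ : Type
  finQ : Finite Q
  finΘ : Finite Θ
  /-- the inclusion of the input alphabet into the tape alphabet -/
  bit : Bool → Θ
  bit_injective : Function.Injective bit
  blank : Θ
  blank_ne_bit : ∀ b, bit b ≠ blank
  δ : Θ → Q → Θ × Q × Bool
  start : Q
  accept : Q
  reject : Q
  accept_ne_reject : accept ≠ reject

namespace TuringMachine

/-- A configuration: state, head position and tape contents. -/
structure Cfg (M : TuringMachine) where
  state : M.Q
  head : ℕ
  tape : ℕ → M.Θ

/-- The tape that holds the string `σ` from position `0` on, followed by blanks only. -/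
def stringTape (M : TuringMachine) (σ : List Bool) : ℕ → M.Θ :=
  fun i => (σ[i]?).elim M.blank M.bit

/-- The initial configuration on input `p`. -/
def init (M : TuringMachine) (p : List Bool) : M.Cfg :=
  ⟨M.start, 0, M.stringTape p⟩

open Classical in
/-- One step of the computation. The machine halts in the accept and in the reject state; a head
at position `0` that is told to move to the left stays where it is (`0 - 1 = 0` in `ℕ`). -/
noncomputable def step (M : TuringMachine) (c : M.Cfg) : M.Cfg :=
  if c.state = M.accept ∨ c.state = M.reject then c
  else
    let r := M.δ (c.tape c.head) c.state
    ⟨r.2.1, if r.2.2 then c.head + 1 else c.head - 1, Function.update c.tape c.head r.1⟩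

/-- `M.Outputs p τ`, written `M(p) = τ`: on input `p`, the machine reaches its accept state, leaving
the string `τ` (followed by blanks) on its tape. -/
def Outputs (M : TuringMachine) (p τ : List Bool) : Prop :=
  ∃ n : ℕ, (M.step^[n] (M.init p)).state = M.accept ∧
    (M.step^[n] (M.init p)).tape = M.stringTape τ

/-- `U` is universal if it simulates every machine `M`: there is a computable encoding
`p ↦ ⟨M, p⟩` of the inputs of `M` such that `U(⟨M, p⟩) = M(p)` for every `p`, one side being
undefined whenever the other one is. -/
def IsUniversal (U : TuringMachine) : Prop :=
  ∀ M : TuringMachine, ∃ e : List Bool → List Bool, Computable e ∧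
    ∀ p τ : List Bool, U.Outputs (e p) τ ↔ M.Outputs p τ

/-- The Kolmogorov complexity `K_U(σ)`: the least length of a string `p` with `U(p) = σ`
(`⊤` if there is none). -/
noncomputable def kolmogorovComplexity (U : TuringMachine) (σ : List Bool) : ℕ∞ :=
  ⨅ (p : List Bool) (_ : U.Outputs p σ), (p.length : ℕ∞)

end TuringMachine

/-! ### Maps generated by a set of maps, and their size -/

/-- A map `f : X → Y` between two sets, together with its domain and its codomain. -/
abbrev SetMap : Type 1 := Σ (X : Type) (Y : Type), X → Y

/-- `Generated 𝓜 f`: the map `f` is in `⟨𝓜⟩`. The set `𝟏` is `Unit`, and a Cartesian product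
`Y₁ × ⋯ × Yₙ` is the type `∀ i : Fin n, Y i` of `n`-tuples. -/
inductive Generated (𝓜 : Set SetMap) : ∀ {X Y : Type}, (X → Y) → Prop
  | base {X Y : Type} (f : X → Y) (hf : (⟨X, Y, f⟩ : SetMap) ∈ 𝓜) : Generated 𝓜 f
  | id (X : Type) : Generated 𝓜 (fun x : X => x)
  | omega (X : Type) : Generated 𝓜 (fun _ : X => ())
  | proj {n : ℕ} (Y : Fin n → Type) (i : Fin n) : Generated 𝓜 (fun y : (∀ j, Y j) => y i)
  | comp {X Y Z : Type} (g : Y → Z) (f : X → Y) (hg : Generated 𝓜 g) (hf : Generated 𝓜 f) :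
      Generated 𝓜 (fun x => g (f x))
  | prod {n : ℕ} (hn : 1 ≤ n) {X : Type} {Y : Fin n → Type} (f : ∀ i, X → Y i)
      (hf : ∀ i, Generated 𝓜 (f i)) : Generated 𝓜 (fun x i => f i x)

/-- `GeneratedIn 𝓜 f k`: the map `f` is built from maps of size `1` (those in `𝓜`, identities,
`ω`, projections) by concatenations and products, where every concatenation and every product
costs `1` more than the sum of the costs of its components, at total cost `k`. -/
inductive GeneratedIn (𝓜 : Set SetMap) : ∀ {X Y : Type}, (X → Y) → ℕ → Prop
  | base {X Y : Type} (f : X → Y) (hf : (⟨X, Y, f⟩ : SetMap) ∈ 𝓜) : GeneratedIn 𝓜 f 1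
  | id (X : Type) : GeneratedIn 𝓜 (fun x : X => x) 1
  | omega (X : Type) : GeneratedIn 𝓜 (fun _ : X => ()) 1
  | proj {n : ℕ} (Y : Fin n → Type) (i : Fin n) : GeneratedIn 𝓜 (fun y : (∀ j, Y j) => y i) 1
  | comp {X Y Z : Type} (g : Y → Z) (f : X → Y) (a b : ℕ)
      (hg : GeneratedIn 𝓜 g a) (hf : GeneratedIn 𝓜 f b) :
      GeneratedIn 𝓜 (fun x => g (f x)) (1 + (a + b))
  | prod {n : ℕ} (hn : 1 ≤ n) {X : Type} {Y : Fin n → Type} (f : ∀ i, X → Y i) (a : Fin n → ℕ)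
      (hf : ∀ i, GeneratedIn 𝓜 (f i) (a i)) : GeneratedIn 𝓜 (fun x i => f i x) (1 + ∑ i, a i)

theorem generated_iff_exists_generatedIn (𝓜 : Set SetMap) {X Y : Type} (f : X → Y) :
    Generated 𝓜 f ↔ ∃ k, GeneratedIn 𝓜 f k := by
  constructor
  · intro h
    induction h with
    | base f hf => exact ⟨1, .base f hf⟩
    | id X => exact ⟨1, .id X⟩
    | omega X => exact ⟨1, .omega X⟩
    | proj Y i => exact ⟨1, .proj Y i⟩
    | comp g f _ _ ihg ihf =>
      obtain ⟨a, ha⟩ := ihg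
      obtain ⟨b, hb⟩ := ihf
      exact ⟨_, .comp g f a b ha hb⟩
    | prod hn f _ ih =>
      choose a ha using ih
      exact ⟨_, .prod hn f a ha⟩
  · rintro ⟨k, h⟩
    induction h with
    | base f hf => exact .base f hf
    | id X => exact .id X
    | omega X => exact .omega X
    | proj Y i => exact .proj Y i
    | comp g f _ _ _ _ ihg ihf => exact .comp g f ihg ihf
    | prod hn f _ _ ih => exact .prod hn f ih

/-- The size `|f|` of a map `f` relative to `𝓜` (`⊤` if `f` is not in `⟨𝓜⟩`). -/
noncomputable def genSize (𝓜 : Set SetMap) {X Y : Type} (f : X → Y) : ℕ∞ :=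
  ⨅ (k : ℕ) (_ : GeneratedIn 𝓜 f k), (k : ℕ∞)

/-! ### Diagrams and their cross sections -/

/-- A diagram `(𝓢, 𝓢', 𝓜)`: a family `𝓢 = (obj i)` of sets, a subfamily `𝓢'`, and a family of maps
between the power sets of members of `𝓢`. The maps from `2^(obj i)` to `2^(obj j)` are indexed by
`Arr i j`, so that the whole family `𝓜` is indexed by `Σ i j, Arr i j`. -/
structure Diagram where
  ι : Type
  obj : ι → Type
  /-- the subfamily `𝓢'` -/
  unionPart : Set ι
  Arr : ι → ι → Type
  map : ∀ {i j : ι}, Arr i j → Set (obj i) → Set (obj j)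

namespace Diagram

/-- A cross section of the family `𝓢`: a subset of each of the sets. -/
abbrev Section (D : Diagram) : Type := ∀ i : D.ι, Set (D.obj i)

/-- `s` is a cross section of the diagram `D`: at each member `j` of `𝓢` with an incoming map, `s j`
is the intersection (the union, if `j` is in `𝓢'`) of the images under the incoming maps. -/
def IsCrossSection (D : Diagram) (s : D.Section) : Prop :=
  ∀ j : D.ι, (∃ i, Nonempty (D.Arr i j)) →
    (j ∉ D.unionPart → s j = ⋂ (i : D.ι) (φ : D.Arr i j), D.map φ (s i)) ∧
    (j ∈ D.unionPart → s j = ⋃ (i : D.ι) (φ : D.Arr i j), D.map φ (s i))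

/-- The set `Γ(𝓢, 𝓢', 𝓜 | t)` of the cross sections of the diagram that restrict to a given
cross section `t` of a subfamily `T` of `𝓢`. -/
def crossSections (D : Diagram) (T : Set D.ι) (t : ∀ i : T, Set (D.obj i)) : Set D.Section :=
  {s | D.IsCrossSection s ∧ ∀ i : T, s i = t i}

/-- The data `(𝓢, 𝓢', 𝓜, T, t, x)` represents the subset `A` of `obj x`: there are cross sections in
`Γ(𝓢, 𝓢', 𝓜 | t)`, and all of them are `A` at `x`. -/
def Represents (D : Diagram) (T : Set D.ι) (t : ∀ i : T, Set (D.obj i)) (x : D.ι)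
    (A : Set (D.obj x)) : Prop :=
  (D.crossSections T t).Nonempty ∧ ∀ s ∈ D.crossSections T t, s x = A

end Diagram

/-- `φ : 2^X → 2^Y` is the power map of `f : X → Y`, `f(A) = {f(x) | x ∈ A}`. -/
def IsPowerMapOf {X Y : Type} (φ : Set X → Set Y) (f : X → Y) : Prop :=
  ∀ A, φ A = f '' A

/-- `φ : 2^X → 2^Y` is the inverse map of `f : Y → X`, `f⁻¹(A) = {y | f(y) ∈ A}`. -/
def IsInverseMapOf {X Y : Type} (φ : Set X → Set Y) (f : Y → X) : Prop :=
  ∀ A, φ A = f ⁻¹' A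

/-- The size of a map `φ : 2^X → 2^Y` between power sets relative to `𝓜`: the size of the map in
`⟨𝓜⟩` of which `φ` is the power map or the inverse map (the least size if there are several such
maps). -/
noncomputable def powerMapSize (𝓜 : Set SetMap) {X Y : Type} (φ : Set X → Set Y) : ℕ∞ :=
  (⨅ (f : X → Y) (_ : IsPowerMapOf φ f), genSize 𝓜 f) ⊓
    (⨅ (f : Y → X) (_ : IsInverseMapOf φ f), genSize 𝓜 f)

namespace Diagram

/-- The diagram is generated by `𝓜` (without complement): each of its maps is the power map or the
inverse map of a map in `⟨𝓜⟩`. -/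
def GeneratedBy (D : Diagram) (𝓜 : Set SetMap) : Prop :=
  ∀ (i j : D.ι) (φ : D.Arr i j),
    (∃ f : D.obj i → D.obj j, Generated 𝓜 f ∧ IsPowerMapOf (D.map φ) f) ∨
    (∃ f : D.obj j → D.obj i, Generated 𝓜 f ∧ IsInverseMapOf (D.map φ) f)

/-- The total size of the maps of the diagram relative to `𝓜`, as an extended natural number: the
supremum of the sums over finitely many of the maps. -/
noncomputable def size (D : Diagram) (𝓜 : Set SetMap) : ℕ∞ :=
  ⨆ F : Finset (Σ (i : D.ι) (j : D.ι), D.Arr i j), ∑ φ ∈ F, powerMapSize 𝓜 (D.map φ.2.2)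

end Diagram

/-! ### Structural information -/

/-- The structural information `I(A | 𝓜)` of a subset `A` of `X` relative to `𝓜`: the least total
size of a diagram that is generated by `𝓜` and represents `A` when the only member of the subfamily
`T` is a set `𝟏` (at the index `o`) and the partial cross section there is all of `𝟏`. It is `⊤` if
no such diagram has finite size. -/
noncomputable def structuralInformation {X : Type} (A : Set X) (𝓜 : Set SetMap) : ℕ∞ :=
  sInf {n : ℕ∞ | ∃ (D : Diagram) (o x : D.ι) (_ : D.obj o = Unit) (hx : X = D.obj x),
    D.GeneratedBy 𝓜 ∧ D.Represents {o} (fun _ => Set.univ) x (cast (congrArg Set hx) A) ∧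
    n = D.size 𝓜}

/-- The structure maps `{0, succ}` of the natural numbers, with `0 : 𝟏 → ℕ` and `succ : ℕ → ℕ`. -/
def natStructureMaps : Set SetMap :=
  {⟨Unit, ℕ, fun _ => 0⟩, ⟨ℕ, ℕ, Nat.succ⟩}

/-- The encoding `σ̄ = {(i, σ[i]) | i < |σ|} ∪ {(|σ|, 0), (|σ|, 1)}` of a binary string as a subset
of `ℕ × ℕ`, whose elements are written as `2`-tuples. -/
def encodeString (σ : List Bool) : Set (Fin 2 → ℕ) :=
  {v | ∃ (i : ℕ) (h : i < σ.length), v = ![i, (σ[i]).toNat]} ∪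
    {![σ.length, 0], ![σ.length, 1]}

/-!
The run of a Turing machine `M` on an input `p` is described by Horn clauses: the relations "at time
`t` the machine is in state `q` with its head at `i`" and "at time `t` the tape holds `a` at `i`"
are subsets of `ℕ × ℕ`, and a relation at time `t + 1` is derived from relations at time `t`. A
system of Horn clauses is a diagram (`HornClause.diagram`): the relations are its union nodes, the
clauses are its intersection nodes, a clause tests a member of its body by an inverse map, and it
derives its head by a power map. Existential quantifiers, in particular over the unknown halting
time, are absorbed by the power maps.

Cross sections of the diagram are the supported models of the clauses
(`HornClause.isCrossSection_diagram_iff`), that is, the fixed points of a monotone operator. Such a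
fixed point need not be unique, but here the premises of a clause always precede its conclusion in a
well-founded order, because time increases, and this forces uniqueness
(`HornClause.IsSupportedModel.eq`). Negation is not available, so that "the head is not at `i`" is
expressed through the inequality relation on `ℕ`, which has a recursive description of its own. The
output is read off at any accepting time; the end of the string is recognized as a blank that is the
first cell or follows a bit.

All clauses but those that spell out the input depend on `M` only. The input costs `4` per bit: one
clause obtains the singleton `{i + 1}` from `{i}` by `succ`, another one adds `i` to the positions
of the bit `p[i]`, and each of them has two maps of size `1`. Hence the output has structural
information at most `4 |p| + c` (`TuringMachine.structuralInformation_encodeString_le`), and the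
theorem follows by taking a shortest program.
-/

/-! ### Horn clauses -/

/-- A Horn clause over a family `obj` of sets: for every value `y` of its variables, it derives that
`headMap y` lies in the subset of `obj head` from the facts that `a.2 y` lies in the subset of
`obj a.1`, for all `a` in `body`. -/
structure HornClause {V : Type} (obj : V → Type) where
  /-- the set of values of the variables -/
  Var : Type
  head : V
  headMap : Var → obj head
  body : List (Σ v, Var → obj v)

namespace HornClause

variable {V R : Type} {obj : V → Type}

/-- The total size of the maps of a clause. -/
noncomputable def cost (𝓜 : Set SetMap) (c : HornClause obj) : ℕ∞ :=
  genSize 𝓜 c.headMap + ∑ k : Fin c.body.length, genSize 𝓜 (c.body.get k).2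

/-- `y` satisfies the body of the clause if the sets are interpreted by `s`. -/
def BodyHolds (c : HornClause obj) (s : ∀ v, Set (obj v)) (y : c.Var) : Prop :=
  ∀ a ∈ c.body, a.2 y ∈ s a.1

/-- An interpretation is a supported model of the clauses if it is closed under them and, except at
the vertex `o`, each of its elements is the conclusion of a clause whose body holds. -/
structure IsSupportedModel (o : V) (C : R → HornClause obj) (s : ∀ v, Set (obj v)) : Prop where
  closed : ∀ r y, (C r).BodyHolds s y → (C r).headMap y ∈ s (C r).head
  supported : ∀ v, v ≠ o → ∀ x ∈ s v, ∃ r y, (C r).BodyHolds s y ∧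
    (⟨v, x⟩ : Σ v, obj v) = ⟨(C r).head, (C r).headMap y⟩

/-- Supported models are unique if the premises of each instance of a clause precede its conclusion
in a well-founded order. -/
theorem IsSupportedModel.eq {o : V} {C : R → HornClause obj} {s t : ∀ v, Set (obj v)}
    {α : Type} [LT α] [WellFoundedLT α] (rank : (Σ v, obj v) → α)
    (hrank : ∀ r y, ∀ a ∈ (C r).body,
      rank ⟨a.1, a.2 y⟩ < rank ⟨(C r).head, (C r).headMap y⟩)
    (hs : IsSupportedModel o C s) (ht : IsSupportedModel o C t) (ho : s o = t o) : s = t := by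
  have key : ∀ z : Σ v, obj v, z.2 ∈ s z.1 ↔ z.2 ∈ t z.1 := by
    intro z
    induction z using (InvImage.wf rank (wellFounded_lt (α := α))).induction with
    | _ z ih =>
      obtain ⟨v, x⟩ := z
      by_cases hv : v = o
      · subst hv
        simp only [ho]
      · constructor
        · intro hx
          obtain ⟨r, y, hb, he⟩ := hs.supported v hv x hx
          rw [he] at ih ⊢
          exact ht.closed r y fun a ha => (ih ⟨a.1, a.2 y⟩ (hrank r y a ha)).1 (hb a ha)
        · intro hx
          obtain ⟨r, y, hb, he⟩ := ht.supported v hv x hx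
          rw [he] at ih ⊢
          exact hs.closed r y fun a ha => (ih ⟨a.1, a.2 y⟩ (hrank r y a ha)).2 (hb a ha)
  funext v
  ext x
  exact key ⟨v, x⟩

/-! ### The diagram of a system of Horn clauses -/

/-- The maps of `HornClause.diagram`: one from each clause to its head, and one to each clause from
each member of its body. -/
inductive DiagramArr (C : R → HornClause obj) : V ⊕ R → V ⊕ R → Type
  | derive (r : R) : DiagramArr C (.inr r) (.inl (C r).head)
  | test (r : R) (k : Fin (C r).body.length) :
      DiagramArr C (.inl ((C r).body.get k).1) (.inr r)

/-- The sets of the diagram of `HornClause.diagram`. -/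
abbrev diagramObj (C : R → HornClause obj) : V ⊕ R → Type
  | .inl v => obj v
  | .inr r => (C r).Var

/-- The diagram of a system of Horn clauses. Its sets are those of the family `obj`, which form the
subfamily where unions are taken, and the sets of values of the variables of the clauses, where
intersections are taken. The members of a body give inverse maps and the heads give power maps. -/
def diagram (C : R → HornClause obj) : Diagram where
  ι := V ⊕ R
  obj := diagramObj C
  unionPart := Set.range Sum.inl
  Arr := DiagramArr C
  map := fun φ => match φ with
    | .derive r => fun A => (C r).headMap '' A
    | .test r k => fun A => ((C r).body.get k).2 ⁻¹' A

/-- The cross sections of the diagram are the supported models, with the bodies of the clauses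
interpreted accordingly. -/
theorem isCrossSection_diagram_iff {o : V} {C : R → HornClause obj}
    (hbody : ∀ r, (C r).body ≠ []) (hhead : ∀ v, (∃ r, (C r).head = v) ↔ v ≠ o)
    (s : (diagram C).Section) :
    (diagram C).IsCrossSection s ↔
      IsSupportedModel o C (fun v => s (.inl v)) ∧
        ∀ r, s (.inr r) = {y | (C r).BodyHolds (fun v => s (.inl v)) y} := by
  have hInter : ∀ r, (⋂ (i : V ⊕ R) (φ : DiagramArr C i (.inr r)), (diagram C).map φ (s i)) =
      {y | (C r).BodyHolds (fun v => s (.inl v)) y} := by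
    intro r
    ext y
    simp only [Set.mem_iInter]
    constructor
    · intro h a ha
      obtain ⟨k, rfl⟩ := List.mem_iff_get.1 ha
      exact h _ (.test r k)
    · intro h i φ
      cases φ with
      | test r k => exact h _ (List.get_mem _ k)
  have hUnion : ∀ v (x : obj v),
      (x ∈ (⋃ (i : V ⊕ R) (φ : DiagramArr C i (.inl v)), (diagram C).map φ (s i) : Set (obj v))) ↔
        ∃ r, ∃ y ∈ (s (.inr r) : Set (C r).Var),
          (⟨v, x⟩ : Σ v, obj v) = ⟨(C r).head, (C r).headMap y⟩ := by
    intro v x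
    constructor
    · intro h
      obtain ⟨i, h⟩ := Set.mem_iUnion.1 h
      obtain ⟨φ, h⟩ := Set.mem_iUnion.1 h
      cases φ with
      | derive r =>
        obtain ⟨y, hy, rfl⟩ := h
        exact ⟨r, y, hy, rfl⟩
    · rintro ⟨r, y, hy, he⟩
      cases he
      exact Set.mem_iUnion.2 ⟨.inr r, Set.mem_iUnion.2 ⟨.derive r, y, hy, rfl⟩⟩
  constructor
  · intro h
    have hr : ∀ r, s (.inr r) = {y | (C r).BodyHolds (fun v => s (.inl v)) y} := by
      intro r
      rw [← hInter r]
      refine (h (.inr r) ⟨_, ⟨.test r ⟨0, List.length_pos_iff.2 (hbody r)⟩⟩⟩).1 ?_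
      rintro ⟨v, hv⟩
      cases hv
    have hv : ∀ v, v ≠ o → ∀ x : obj v, x ∈ (s (.inl v) : Set (obj v)) ↔
        ∃ r, ∃ y ∈ (s (.inr r) : Set (C r).Var),
          (⟨v, x⟩ : Σ v, obj v) = ⟨(C r).head, (C r).headMap y⟩ := by
      intro v hv x
      obtain ⟨r, rfl⟩ := (hhead v).2 hv
      rw [← hUnion]
      exact Set.ext_iff.1 ((h (.inl (C r).head) ⟨_, ⟨.derive r⟩⟩).2 ⟨_, rfl⟩) x
    refine ⟨⟨fun r y hy => ?_, fun v hvo x hx => ?_⟩, hr⟩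
    · refine (hv _ ((hhead _).1 ⟨r, rfl⟩) _).2 ⟨r, y, ?_, rfl⟩
      rw [hr r]
      exact hy
    · obtain ⟨r, y, hy, he⟩ := (hv v hvo x).1 hx
      rw [hr r] at hy
      exact ⟨r, y, hy, he⟩
  · rintro ⟨hm, hr⟩ (v | r) ⟨i, ⟨φ⟩⟩
    · refine ⟨fun h => (h ⟨v, rfl⟩).elim, fun _ => ?_⟩
      have hvo : v ≠ o := by
        cases φ with
        | derive r => exact (hhead _).1 ⟨r, rfl⟩
      refine Set.ext fun x => Iff.trans ?_ (hUnion v x).symm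
      constructor
      · intro hx
        obtain ⟨r, y, hy, he⟩ := hm.supported v hvo x hx
        refine ⟨r, y, ?_, he⟩
        rw [hr r]
        exact hy
      · rintro ⟨r, y, hy, he⟩
        rw [hr r] at hy
        cases he
        exact hm.closed r y hy
    · refine ⟨fun _ => (hr r).trans (hInter r).symm, ?_⟩
      rintro ⟨v, hv⟩
      cases hv

theorem size_diagram_le [Fintype R] (𝓜 : Set SetMap) (C : R → HornClause obj) :
    (diagram C).size 𝓜 ≤ ∑ r, (C r).cost 𝓜 := by
  classical
  let toArr : (Σ r, Option (Fin (C r).body.length)) → Σ (i j : V ⊕ R), DiagramArr C i j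
    | ⟨r, none⟩ => ⟨_, _, .derive r⟩
    | ⟨r, some k⟩ => ⟨_, _, .test r k⟩
  have hsurj : Function.Surjective toArr := by
    rintro ⟨i, j, r | ⟨r, k⟩⟩
    · exact ⟨⟨r, none⟩, rfl⟩
    · exact ⟨⟨r, some k⟩, rfl⟩
  refine iSup_le fun F => ?_
  let g := Function.surjInv hsurj
  let F' : Finset (Σ (i j : V ⊕ R), DiagramArr C i j) := F
  calc ∑ φ ∈ F', powerMapSize 𝓜 ((diagram C).map φ.2.2)
      = ∑ e ∈ F'.map ⟨g, Function.injective_surjInv hsurj⟩,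
          powerMapSize 𝓜 ((diagram C).map (toArr e).2.2) := by
        rw [Finset.sum_map]
        refine Finset.sum_congr rfl fun φ _ => ?_
        have : toArr (g φ) = φ := Function.surjInv_eq hsurj φ
        simp only [Function.Embedding.coeFn_mk]
        rw [this]
    _ ≤ ∑ e, powerMapSize 𝓜 ((diagram C).map (toArr e).2.2) :=
        Finset.sum_le_sum_of_subset (Finset.subset_univ _)
    _ ≤ ∑ r, (C r).cost 𝓜 := by
        rw [Fintype.sum_sigma]
        refine Finset.sum_le_sum fun r _ => ?_
        rw [Fintype.sum_option]
        refine add_le_add ?_ (Finset.sum_le_sum fun k _ => ?_)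
        · exact inf_le_left.trans (iInf₂_le (C r).headMap fun _ => rfl)
        · exact inf_le_right.trans (iInf₂_le ((C r).body.get k).2 fun _ => rfl)

/-- A subset that is defined by a unique supported model has at most the structural information of
the clauses. Every vertex except `o` has to be the head of a clause, and no body may be empty,
because a diagram does not constrain the sets without incoming maps. -/
theorem structuralInformation_le [Fintype R] (𝓜 : Set SetMap) {o : V} (hobj : obj o = Unit)
    (C : R → HornClause obj)
    (hgen : ∀ r, Generated 𝓜 (C r).headMap ∧ ∀ a ∈ (C r).body, Generated 𝓜 a.2)
    (hbody : ∀ r, (C r).body ≠ []) (hhead : ∀ v, (∃ r, (C r).head = v) ↔ v ≠ o)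
    {m : ∀ v, Set (obj v)} (hm : IsSupportedModel o C m) (hmo : m o = Set.univ)
    (huniq : ∀ s, IsSupportedModel o C s → s o = Set.univ → s = m) (x : V) :
    structuralInformation (m x) 𝓜 ≤ ∑ r, (C r).cost 𝓜 := by
  refine le_trans (sInf_le ⟨diagram C, .inl o, .inl x, hobj, rfl, ?_, ⟨?_, ?_⟩, rfl⟩)
    (size_diagram_le 𝓜 C)
  · rintro i j (r | ⟨r, k⟩)
    · exact .inl ⟨_, (hgen r).1, fun _ => rfl⟩
    · exact .inr ⟨_, (hgen r).2 _ (List.get_mem _ k), fun _ => rfl⟩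
  · let s : (diagram C).Section := fun i => match i with
      | .inl v => m v
      | .inr r => {y | (C r).BodyHolds m y}
    refine ⟨s, (isCrossSection_diagram_iff hbody hhead s).2 ⟨hm, fun r => rfl⟩, ?_⟩
    rintro ⟨i, rfl⟩
    exact hmo
  · rintro s ⟨hs, ho⟩
    exact congrFun (huniq _ ((isCrossSection_diagram_iff hbody hhead s).1 hs).1
      (ho ⟨.inl o, rfl⟩)) x

end HornClause

/-! ### Small maps on tuples of natural numbers -/

theorem genSize_le {𝓜 : Set SetMap} {X Y : Type} {f : X → Y} {k : ℕ} (h : GeneratedIn 𝓜 f k) :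
    genSize 𝓜 f ≤ k :=
  iInf₂_le k h

/-- `f` can be built from `0` and `succ` at cost at most `n`. -/
def NatSizeLE {X Y : Type} (f : X → Y) (n : ℕ) : Prop :=
  ∃ k ≤ n, GeneratedIn natStructureMaps f k

namespace NatSizeLE

variable {X Y Z : Type}

theorem genSize_le {f : X → Y} {n : ℕ} (h : NatSizeLE f n) :
    genSize natStructureMaps f ≤ n := by
  obtain ⟨k, hk, h⟩ := h
  exact (_root_.genSize_le h).trans (by exact_mod_cast hk)

theorem generated {f : X → Y} {n : ℕ} (h : NatSizeLE f n) : Generated natStructureMaps f := by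
  obtain ⟨k, -, h⟩ := h
  exact (generated_iff_exists_generatedIn _ _).2 ⟨k, h⟩

theorem mono {f : X → Y} {m n : ℕ} (h : NatSizeLE f m) (hmn : m ≤ n) : NatSizeLE f n := by
  obtain ⟨k, hk, h⟩ := h
  exact ⟨k, hk.trans hmn, h⟩

theorem id : NatSizeLE (fun x : X => x) 1 := ⟨1, le_rfl, .id X⟩

theorem omega : NatSizeLE (fun _ : X => ()) 1 := ⟨1, le_rfl, .omega X⟩

theorem proj {n : ℕ} (i : Fin n) : NatSizeLE (fun y : Fin n → ℕ => y i) 1 :=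
  ⟨1, le_rfl, .proj (fun _ => ℕ) i⟩

theorem natSucc : NatSizeLE Nat.succ 1 := ⟨1, le_rfl, .base _ (.inr rfl)⟩

theorem comp {g : Y → Z} {f : X → Y} {a b : ℕ} (hg : NatSizeLE g a) (hf : NatSizeLE f b) :
    NatSizeLE (fun x => g (f x)) (1 + (a + b)) := by
  obtain ⟨k, hk, hg⟩ := hg
  obtain ⟨l, hl, hf⟩ := hf
  exact ⟨_, by omega, .comp g f k l hg hf⟩

theorem add_one {f : X → ℕ} {n : ℕ} (hf : NatSizeLE f n) :
    NatSizeLE (fun x => f x + 1) (1 + (1 + n)) :=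
  natSucc.comp hf

theorem zero : NatSizeLE (fun _ : X => 0) 3 :=
  comp (g := fun _ : Unit => 0) (f := fun _ : X => ()) (a := 1) (b := 1)
    ⟨1, le_rfl, .base _ (.inl rfl)⟩ omega

theorem toNat (b : Bool) : NatSizeLE (fun _ : X => b.toNat) 5 := by
  cases b
  · exact zero.mono (by omega)
  · exact zero.add_one

theorem pair {f g : X → ℕ} {a b : ℕ} (hf : NatSizeLE f a) (hg : NatSizeLE g b) :
    NatSizeLE (fun x => ![f x, g x]) (1 + (a + b)) := by
  obtain ⟨k, hk, hf⟩ := hf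
  obtain ⟨l, hl, hg⟩ := hg
  have h := GeneratedIn.prod (𝓜 := natStructureMaps) (n := 2) (by omega) (Y := fun _ => ℕ)
    ![f, g] ![k, l] (by intro i; fin_cases i; exacts [hf, hg])
  refine ⟨1 + (k + l), by omega, ?_⟩
  convert h using 1
  · funext x i
    fin_cases i <;> rfl
  · simp

end NatSizeLE

/-! ### Runs of a Turing machine -/

namespace TuringMachine

variable (M : TuringMachine)

/-- The displacement of the head: to the right, to the left (staying at `0`), or none. -/
def shift : Option Bool → ℕ → ℕ
  | none, i => i
  | some true, i => i + 1
  | some false, i => i - 1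

open Classical in
/-- The transition function extended to the accept and the reject state, where the machine neither
changes the tape nor moves the head. -/
noncomputable def next (a : M.Θ) (q : M.Q) : M.Θ × M.Q × Option Bool :=
  if q = M.accept ∨ q = M.reject then (a, q, none)
  else ((M.δ a q).1, (M.δ a q).2.1, some (M.δ a q).2.2)

/-- A step of the machine is the same in halting and in other states, in terms of `next`. -/
theorem step_eq (c : M.Cfg) :
    M.step c = ⟨(M.next (c.tape c.head) c.state).2.1,
      shift (M.next (c.tape c.head) c.state).2.2 c.head,
      Function.update c.tape c.head (M.next (c.tape c.head) c.state).1⟩ := by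
  unfold step next
  split_ifs with h
  · simp [shift]
  · cases hd : (M.δ (c.tape c.head) c.state).2.2 <;> simp [shift, hd]

/-- The configuration at time `n` on input `p`. -/
noncomputable def run (p : List Bool) (n : ℕ) : M.Cfg := M.step^[n] (M.init p)

theorem run_succ (p : List Bool) (n : ℕ) : M.run p (n + 1) = M.step (M.run p n) :=
  Function.iterate_succ_apply' _ _ _

theorem run_eq_of_accept {p : List Bool} {n : ℕ} (h : (M.run p n).state = M.accept) (k : ℕ) :
    M.run p (n + k) = M.run p n := by
  induction k with
  | zero => rfl
  | succ k ih =>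
    rw [← add_assoc, run_succ, ih, step, if_pos (.inl h)]

/-- The contents of the tape are the same at all accepting times. -/
theorem Outputs.tape_eq {M : TuringMachine} {p τ : List Bool} (h : M.Outputs p τ) {n : ℕ}
    (hn : (M.run p n).state = M.accept) : (M.run p n).tape = M.stringTape τ := by
  obtain ⟨m, hm, hτ⟩ := h
  change (M.run p m).state = M.accept at hm
  change (M.run p m).tape = _ at hτ
  rw [← hτ]
  rcases le_total m n with hmn | hmn
  · obtain ⟨k, rfl⟩ := Nat.exists_eq_add_of_le hmn
    rw [M.run_eq_of_accept hm]
  · obtain ⟨k, rfl⟩ := Nat.exists_eq_add_of_le hmn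
    rw [M.run_eq_of_accept hn]

theorem stringTape_eq_bit_iff {σ : List Bool} {i : ℕ} {b : Bool} :
    M.stringTape σ i = M.bit b ↔ σ[i]? = some b := by
  unfold stringTape
  cases h : σ[i]? with
  | none => simp [(M.blank_ne_bit b).symm]
  | some c => simp [M.bit_injective.eq_iff]

theorem stringTape_eq_blank_iff {σ : List Bool} {i : ℕ} :
    M.stringTape σ i = M.blank ↔ σ.length ≤ i := by
  unfold stringTape
  cases h : σ[i]? with
  | none => simpa using h
  | some c =>
    have := (List.getElem?_eq_some_iff.1 h).1
    simp [M.blank_ne_bit c, this]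

/-! ### Horn clauses that describe a run -/

/-- The relations in the description of a run on an input of length `k`. -/
inductive RunRel (M : TuringMachine) (k : ℕ) : Type
  /-- the given set `𝟏` -/
  | unit
  /-- the singleton `{i}` -/
  | pos (i : Fin (k + 1))
  /-- the positions of a bit in the input -/
  | input (b : Bool)
  /-- the positions behind the input -/
  | tail
  /-- the inequality relation -/
  | ne
  /-- the graph of a head displacement -/
  | move (d : Option Bool)
  /-- the pairs `(t, i)` such that at time `t` the machine is in state `q` with its head at `i` -/
  | head (q : M.Q)
  /-- the pairs `(t, i)` such that at time `t` the tape holds `a` at `i` -/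
  | cell (a : M.Θ)
  /-- the encoded output -/
  | out

/-- The sets of which the relations are subsets. -/
abbrev RunRel.obj {M : TuringMachine} {k : ℕ} : RunRel M k → Type
  | .unit => Unit
  | .pos _ | .input _ | .tail => ℕ
  | .ne | .move _ | .head _ | .cell _ | .out => Fin 2 → ℕ

/-- The names of the clauses whose number does not depend on the input. -/
inductive RunRule (M : TuringMachine) : Type
  | posZero
  | tailBase
  | tailStep
  | neLeft
  | neRight
  | neStep
  | moveStay
  | moveRight
  | moveLeft
  | moveLeftZero
  | inputFalse (b : Bool)
  | headFalse (q : M.Q)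
  | cellInput (b : Bool)
  | cellTail
  | headStart
  | write (q : M.Q) (a : M.Θ)
  | keep (q : M.Q) (a : M.Θ)
  | go (q : M.Q) (a : M.Θ)
  | outBit (b : Bool)
  | outEndZero (b : Bool)
  | outEnd (b c : Bool)

instance : Finite (RunRule M) := by
  have := M.finQ
  have := M.finΘ
  let f : Fin 12 ⊕ (Fin 4 × Bool) ⊕ (Bool × Bool) ⊕ M.Q ⊕ (Fin 3 × M.Q × M.Θ) → RunRule M
    | .inl i => ![.posZero, .tailBase, .tailStep, .neLeft, .neRight, .neStep, .moveStay,
        .moveRight, .moveLeft, .moveLeftZero, .cellTail, .headStart] i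
    | .inr (.inl (i, b)) => ![.inputFalse b, .cellInput b, .outBit b, .outEndZero b] i
    | .inr (.inr (.inl (b, c))) => .outEnd b c
    | .inr (.inr (.inr (.inl q))) => .headFalse q
    | .inr (.inr (.inr (.inr (i, q, a)))) => ![.write q a, .keep q a, .go q a] i
  refine Finite.of_surjective f fun r => ?_
  cases r with
  | posZero => exact ⟨.inl 0, rfl⟩
  | tailBase => exact ⟨.inl 1, rfl⟩
  | tailStep => exact ⟨.inl 2, rfl⟩
  | neLeft => exact ⟨.inl 3, rfl⟩
  | neRight => exact ⟨.inl 4, rfl⟩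
  | neStep => exact ⟨.inl 5, rfl⟩
  | moveStay => exact ⟨.inl 6, rfl⟩
  | moveRight => exact ⟨.inl 7, rfl⟩
  | moveLeft => exact ⟨.inl 8, rfl⟩
  | moveLeftZero => exact ⟨.inl 9, rfl⟩
  | cellTail => exact ⟨.inl 10, rfl⟩
  | headStart => exact ⟨.inl 11, rfl⟩
  | inputFalse b => exact ⟨.inr (.inl (0, b)), rfl⟩
  | cellInput b => exact ⟨.inr (.inl (1, b)), rfl⟩
  | outBit b => exact ⟨.inr (.inl (2, b)), rfl⟩
  | outEndZero b => exact ⟨.inr (.inl (3, b)), rfl⟩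
  | outEnd b c => exact ⟨.inr (.inr (.inl (b, c))), rfl⟩
  | headFalse q => exact ⟨.inr (.inr (.inr (.inl q))), rfl⟩
  | write q a => exact ⟨.inr (.inr (.inr (.inr (0, q, a)))), rfl⟩
  | keep q a => exact ⟨.inr (.inr (.inr (.inr (1, q, a)))), rfl⟩
  | go q a => exact ⟨.inr (.inr (.inr (.inr (2, q, a)))), rfl⟩

variable {M}

/-- The clauses whose number does not depend on the input. The variables are three natural numbers,
usually a time `y 0` and two positions `y 1` and `y 2`. The clauses `inputFalse` and `headFalse`
derive nothing, since their premise never holds; they ensure that each relation is the head of a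
clause. -/
noncomputable def RunRule.clause (k : ℕ) : RunRule M → HornClause (RunRel.obj (M := M) (k := k))
  | .posZero => ⟨Fin 3 → ℕ, .pos 0, fun _ => (0 : ℕ), [⟨.unit, fun _ => ()⟩]⟩
  | .tailBase => ⟨Fin 3 → ℕ, .tail, fun y => y 0, [⟨.pos (Fin.last k), fun y => y 0⟩]⟩
  | .tailStep => ⟨Fin 3 → ℕ, .tail, fun y => y 0 + 1, [⟨.tail, fun y => y 0⟩]⟩
  | .neLeft => ⟨Fin 3 → ℕ, .ne, fun y => ![0, y 0 + 1], [⟨.unit, fun _ => ()⟩]⟩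
  | .neRight => ⟨Fin 3 → ℕ, .ne, fun y => ![y 0 + 1, 0], [⟨.unit, fun _ => ()⟩]⟩
  | .neStep => ⟨Fin 3 → ℕ, .ne, fun y => ![y 0 + 1, y 1 + 1], [⟨.ne, fun y => ![y 0, y 1]⟩]⟩
  | .moveStay => ⟨Fin 3 → ℕ, .move none, fun y => ![y 0, y 0], [⟨.unit, fun _ => ()⟩]⟩
  | .moveRight =>
    ⟨Fin 3 → ℕ, .move (some true), fun y => ![y 0, y 0 + 1], [⟨.unit, fun _ => ()⟩]⟩
  | .moveLeft =>
    ⟨Fin 3 → ℕ, .move (some false), fun y => ![y 0 + 1, y 0], [⟨.unit, fun _ => ()⟩]⟩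
  | .moveLeftZero =>
    ⟨Fin 3 → ℕ, .move (some false), fun _ => ![0, 0], [⟨.unit, fun _ => ()⟩]⟩
  | .inputFalse b => ⟨Fin 3 → ℕ, .input b, fun y => y 0, [⟨.ne, fun y => ![y 0, y 0]⟩]⟩
  | .headFalse q =>
    ⟨Fin 3 → ℕ, .head q, fun y => ![y 0, y 0], [⟨.ne, fun y => ![y 0, y 0]⟩]⟩
  | .cellInput b =>
    ⟨Fin 3 → ℕ, .cell (M.bit b), fun y => ![0, y 1], [⟨.input b, fun y => y 1⟩]⟩
  | .cellTail => ⟨Fin 3 → ℕ, .cell M.blank, fun y => ![0, y 1], [⟨.tail, fun y => y 1⟩]⟩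
  | .headStart => ⟨Fin 3 → ℕ, .head M.start, fun _ => ![0, 0], [⟨.unit, fun _ => ()⟩]⟩
  -- The head is at `y 1`.
  | .write q a =>
    ⟨Fin 3 → ℕ, .cell (M.next a q).1, fun y => ![y 0 + 1, y 1],
      [⟨.head q, fun y => ![y 0, y 1]⟩, ⟨.cell a, fun y => ![y 0, y 1]⟩]⟩
  -- The head is at `y 2`, and the cell at `y 1` is a different one.
  | .keep q a =>
    ⟨Fin 3 → ℕ, .cell a, fun y => ![y 0 + 1, y 1],
      [⟨.head q, fun y => ![y 0, y 2]⟩, ⟨.cell a, fun y => ![y 0, y 1]⟩,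
        ⟨.ne, fun y => ![y 1, y 2]⟩]⟩
  -- The head moves from `y 1` to `y 2`.
  | .go q a =>
    ⟨Fin 3 → ℕ, .head (M.next a q).2.1, fun y => ![y 0 + 1, y 2],
      [⟨.head q, fun y => ![y 0, y 1]⟩, ⟨.cell a, fun y => ![y 0, y 1]⟩,
        ⟨.move (M.next a q).2.2, fun y => ![y 1, y 2]⟩]⟩
  -- The machine accepts at time `y 0`, where the position `y 2` of the head does not matter.
  | .outBit b =>
    ⟨Fin 3 → ℕ, .out, fun y => ![y 1, b.toNat],
      [⟨.head M.accept, fun y => ![y 0, y 2]⟩, ⟨.cell (M.bit b), fun y => ![y 0, y 1]⟩]⟩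
  | .outEndZero b =>
    ⟨Fin 3 → ℕ, .out, fun _ => ![0, b.toNat],
      [⟨.head M.accept, fun y => ![y 0, y 2]⟩, ⟨.cell M.blank, fun y => ![y 0, 0]⟩]⟩
  | .outEnd b c =>
    ⟨Fin 3 → ℕ, .out, fun y => ![y 1 + 1, b.toNat],
      [⟨.head M.accept, fun y => ![y 0, y 2]⟩, ⟨.cell M.blank, fun y => ![y 0, y 1 + 1]⟩,
        ⟨.cell (M.bit c), fun y => ![y 0, y 1]⟩]⟩

/-- All clauses of the description of the run on input `p`. Besides those of `RunRule.clause`, there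
are two for each position `i` of the input: one obtains `{i + 1}` from `{i}`, and one puts `i` into
the set of positions of the bit `p[i]`. -/
noncomputable def runClause (M : TuringMachine) (p : List Bool) :
    (Fin p.length ⊕ Fin p.length) ⊕ RunRule M →
      HornClause (RunRel.obj (M := M) (k := p.length))
  | .inl (.inl i) => ⟨ℕ, .pos i.succ, Nat.succ, [⟨.pos i.castSucc, fun n => n⟩]⟩
  | .inl (.inr i) => ⟨ℕ, .input p[i], fun n => n, [⟨.pos i.castSucc, fun n => n⟩]⟩
  | .inr r => r.clause p.length

/-- The intended interpretation of the relations. -/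
noncomputable def runModel (M : TuringMachine) (p σ : List Bool) :
    ∀ v : RunRel M p.length, Set v.obj
  | .unit => Set.univ
  | .pos i => ({(i : ℕ)} : Set ℕ)
  | .input b => {n : ℕ | p[n]? = some b}
  | .tail => {n : ℕ | p.length ≤ n}
  | .ne => {y : Fin 2 → ℕ | y 0 ≠ y 1}
  | .move d => {y : Fin 2 → ℕ | y 1 = shift d (y 0)}
  | .head q => {y : Fin 2 → ℕ | (M.run p (y 0)).state = q ∧ (M.run p (y 0)).head = y 1}
  | .cell a => {y : Fin 2 → ℕ | (M.run p (y 0)).tape (y 1) = a}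
  | .out => encodeString σ

/-- The position of a fact about the relations in the lexicographic order in which the facts are
derived: facts about the input first, then the run, ordered by time, then the output. -/
def runRank {k : ℕ} : (Σ v : RunRel M k, v.obj) → ℕ ×ₗ ℕ
  | ⟨.unit, _⟩ => toLex (0, 0)
  | ⟨.pos i, _⟩ => toLex (0, i + 1)
  | ⟨.input _, _⟩ => toLex (1, 0)
  | ⟨.tail, n⟩ => toLex (1, (n : ℕ))
  | ⟨.ne, y⟩ => toLex (0, (y : Fin 2 → ℕ) 0 + 1)
  | ⟨.move _, _⟩ => toLex (0, 1)
  | ⟨.head _, y⟩ => toLex (2, (y : Fin 2 → ℕ) 0)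
  | ⟨.cell _, y⟩ => toLex (2, (y : Fin 2 → ℕ) 0)
  | ⟨.out, _⟩ => toLex (3, 0)

/-- The premises of each instance of a clause precede its conclusion. -/
theorem runRank_lt (p : List Bool) (r) (y : (runClause M p r).Var) :
    ∀ a ∈ (runClause M p r).body,
      runRank ⟨a.1, a.2 y⟩ < runRank ⟨(runClause M p r).head, (runClause M p r).headMap y⟩ := by
  have left : ∀ {m n m' n' : ℕ}, m < m' → toLex (m, n) < toLex (m', n') :=
    fun h => Prod.Lex.toLex_lt_toLex.2 (.inl h)
  have right : ∀ {m n n' : ℕ}, n < n' → toLex (m, n) < toLex (m, n') :=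
    fun h => Prod.Lex.toLex_lt_toLex.2 (.inr ⟨rfl, h⟩)
  have h01 : 0 < 1 := Nat.zero_lt_one
  have h02 : 0 < 2 := Nat.zero_lt_two
  have h12 : 1 < 2 := Nat.one_lt_two
  have h23 : 2 < 3 := Nat.lt_succ_self 2
  refine List.forall_iff_forall_mem.1 ?_
  rcases r with (i | i) | r
  · exact right (Nat.lt_succ_self _)
  · exact left h01
  · cases r with
    | posZero | neLeft | neRight | moveStay | moveRight | moveLeft | moveLeftZero =>
      exact right (Nat.succ_pos _)
    | tailStep | neStep => exact right (Nat.lt_succ_self _)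
    | tailBase | inputFalse b => exact left h01
    | headFalse q | headStart => exact left h02
    | cellInput b | cellTail => exact left h12
    | write q a => exact ⟨right (Nat.lt_succ_self _), right (Nat.lt_succ_self _)⟩
    | keep q a | go q a =>
      exact ⟨right (Nat.lt_succ_self _), right (Nat.lt_succ_self _), left h02⟩
    | outBit b | outEndZero b => exact ⟨left h23, left h23⟩
    | outEnd b c => exact ⟨left h23, left h23, left h23⟩

theorem runClause_body_ne_nil (p : List Bool) (r) : (runClause M p r).body ≠ [] := by
  rcases r with (i | i) | r
  · simp [runClause]
  · simp [runClause]
  · cases r <;> simp [runClause, RunRule.clause]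

theorem exists_runClause_head_eq_iff (p : List Bool) (v : RunRel M p.length) :
    (∃ r, (runClause M p r).head = v) ↔ v ≠ .unit := by
  constructor
  · rintro ⟨(i | i) | r, rfl⟩
    · simp [runClause]
    · simp [runClause]
    · cases r <;> simp [runClause, RunRule.clause]
  · intro hv
    cases v with
    | unit => exact (hv rfl).elim
    | pos i =>
      cases i using Fin.cases with
      | zero => exact ⟨.inr .posZero, rfl⟩
      | succ i => exact ⟨.inl (.inl i), rfl⟩
    | input b => exact ⟨.inr (.inputFalse b), rfl⟩
    | tail => exact ⟨.inr .tailBase, rfl⟩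
    | ne => exact ⟨.inr .neLeft, rfl⟩
    | move d =>
      rcases d with _ | _ | _
      · exact ⟨.inr .moveStay, rfl⟩
      · exact ⟨.inr .moveLeft, rfl⟩
      · exact ⟨.inr .moveRight, rfl⟩
    | head q => exact ⟨.inr (.headFalse q), rfl⟩
    | cell a => exact ⟨.inr (.keep M.start a), rfl⟩
    | out => exact ⟨.inr (.outBit false), rfl⟩

/-- The maps of the clauses that do not depend on the input have size at most `11`, the size of the
pair of two maps that are constantly `1`. -/
theorem natSizeLE_clause (k : ℕ) (r : RunRule M) :
    NatSizeLE (r.clause k).headMap 11 ∧ ∀ a ∈ (r.clause k).body, NatSizeLE a.2 11 := by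
  have h1 : ∀ i : Fin 3, NatSizeLE (fun y : Fin 3 → ℕ => y i) 5 :=
    fun i => (NatSizeLE.proj i).mono (by omega)
  have h2 : ∀ i : Fin 3, NatSizeLE (fun y : Fin 3 → ℕ => y i + 1) 5 :=
    fun i => (NatSizeLE.proj i).add_one.mono (by omega)
  have h3 : NatSizeLE (fun _ : Fin 3 → ℕ => 0) 5 := NatSizeLE.zero.mono (by omega)
  have h4 : ∀ b : Bool, NatSizeLE (fun _ : Fin 3 → ℕ => b.toNat) 5 := NatSizeLE.toNat
  have h5 : NatSizeLE (fun _ : Fin 3 → ℕ => ()) 11 := NatSizeLE.omega.mono (by omega)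
  have hm : ∀ {f : (Fin 3 → ℕ) → ℕ}, NatSizeLE f 5 → NatSizeLE f 11 := fun h => h.mono (by omega)
  suffices h : NatSizeLE (r.clause k).headMap 11 ∧
      (r.clause k).body.Forall fun a => NatSizeLE a.2 11 from
    ⟨h.1, List.forall_iff_forall_mem.1 h.2⟩
  cases r with
  | posZero => exact ⟨hm h3, h5⟩
  | tailBase => exact ⟨hm (h1 0), hm (h1 0)⟩
  | tailStep => exact ⟨hm (h2 0), hm (h1 0)⟩
  | neLeft => exact ⟨h3.pair (h2 0), h5⟩
  | neRight => exact ⟨(h2 0).pair h3, h5⟩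
  | neStep => exact ⟨(h2 0).pair (h2 1), (h1 0).pair (h1 1)⟩
  | moveStay => exact ⟨(h1 0).pair (h1 0), h5⟩
  | moveRight => exact ⟨(h1 0).pair (h2 0), h5⟩
  | moveLeft => exact ⟨(h2 0).pair (h1 0), h5⟩
  | moveLeftZero => exact ⟨h3.pair h3, h5⟩
  | inputFalse b => exact ⟨hm (h1 0), (h1 0).pair (h1 0)⟩
  | headFalse q => exact ⟨(h1 0).pair (h1 0), (h1 0).pair (h1 0)⟩
  | cellInput b => exact ⟨h3.pair (h1 1), hm (h1 1)⟩
  | cellTail => exact ⟨h3.pair (h1 1), hm (h1 1)⟩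
  | headStart => exact ⟨h3.pair h3, h5⟩
  | write q a => exact ⟨(h2 0).pair (h1 1), (h1 0).pair (h1 1), (h1 0).pair (h1 1)⟩
  | keep q a =>
    exact ⟨(h2 0).pair (h1 1), (h1 0).pair (h1 2), (h1 0).pair (h1 1), (h1 1).pair (h1 2)⟩
  | go q a =>
    exact ⟨(h2 0).pair (h1 2), (h1 0).pair (h1 1), (h1 0).pair (h1 1), (h1 1).pair (h1 2)⟩
  | outBit b => exact ⟨(h1 1).pair (h4 b), (h1 0).pair (h1 2), (h1 0).pair (h1 1)⟩
  | outEndZero b => exact ⟨h3.pair (h4 b), (h1 0).pair (h1 2), (h1 0).pair h3⟩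
  | outEnd b c =>
    exact ⟨(h2 1).pair (h4 b), (h1 0).pair (h1 2), (h1 0).pair (h2 1), (h1 0).pair (h1 1)⟩

/-- A clause that does not depend on the input has a head and at most three premises, with maps of
size at most `11`. -/
theorem cost_clause_le (k : ℕ) (r : RunRule M) : (r.clause k).cost natStructureMaps ≤ 44 := by
  obtain ⟨h, hb⟩ := natSizeLE_clause k r
  have hlen : (r.clause k).body.length ≤ 3 := by
    cases r <;> simp [RunRule.clause]
  calc (r.clause k).cost natStructureMaps
      ≤ (11 : ℕ) + ∑ _k : Fin (r.clause k).body.length, ((11 : ℕ) : ℕ∞) :=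
        add_le_add h.genSize_le
          (Finset.sum_le_sum fun i _ => (hb _ (List.get_mem _ i)).genSize_le)
    _ = ((11 + (r.clause k).body.length * 11 : ℕ) : ℕ∞) := by simp
    _ ≤ 44 := by
        have : 11 + (r.clause k).body.length * 11 ≤ 44 := by omega
        exact_mod_cast this

theorem end_mem_encodeString {σ : List Bool} {n : ℕ} (hn : σ.length = n) (b : Bool) :
    ![n, b.toNat] ∈ encodeString σ := by
  subst hn
  cases b
  · exact .inr (.inl rfl)
  · exact .inr (.inr rfl)

/-- The intended interpretation is closed under the clauses: the clauses are sound. -/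
theorem runModel_closed {p σ : List Bool} (h : M.Outputs p σ) (r)
    (y : (runClause M p r).Var) (hy : (runClause M p r).BodyHolds (runModel M p σ) y) :
    (runClause M p r).headMap y ∈ runModel M p σ (runClause M p r).head := by
  have hb := List.forall_iff_forall_mem.2 hy
  rcases r with (i | i) | r
  · exact congrArg Nat.succ (show y = (i : ℕ) from hb)
  · obtain rfl : y = (i : ℕ) := hb
    exact List.getElem?_eq_getElem i.2
  · cases r with
    | posZero => exact rfl
    | tailBase => exact (show y 0 = p.length from hb).ge
    | tailStep => exact Nat.le_succ_of_le (show p.length ≤ y 0 from hb)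
    | neLeft => exact (Nat.succ_ne_zero _).symm
    | neRight => exact Nat.succ_ne_zero _
    | neStep => exact fun h => (show y 0 ≠ y 1 from hb) (Nat.succ.inj h)
    | moveStay | moveRight | moveLeft | moveLeftZero => exact rfl
    | inputFalse b | headFalse q => exact ((show y 0 ≠ y 0 from hb) rfl).elim
    | cellInput b => exact M.stringTape_eq_bit_iff.2 hb
    | cellTail => exact M.stringTape_eq_blank_iff.2 hb
    | headStart => exact ⟨rfl, rfl⟩
    | write q a =>
      obtain ⟨⟨hq, hi⟩, ha⟩ : ((M.run p (y 0)).state = q ∧ (M.run p (y 0)).head = y 1) ∧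
        (M.run p (y 0)).tape (y 1) = a := hb
      change (M.run p (y 0 + 1)).tape (y 1) = _
      rw [run_succ, step_eq]
      dsimp only
      rw [← hi, Function.update_self, hi, ha, hq]
    | keep q a =>
      obtain ⟨⟨hq, hi⟩, ha, hne⟩ : ((M.run p (y 0)).state = q ∧ (M.run p (y 0)).head = y 2) ∧
        (M.run p (y 0)).tape (y 1) = a ∧ y 1 ≠ y 2 := hb
      change (M.run p (y 0 + 1)).tape (y 1) = _
      rw [run_succ, step_eq]
      dsimp only
      rw [Function.update_of_ne (hi ▸ hne), ha]
    | go q a =>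
      obtain ⟨⟨hq, hi⟩, ha, hd⟩ : ((M.run p (y 0)).state = q ∧ (M.run p (y 0)).head = y 1) ∧
        (M.run p (y 0)).tape (y 1) = a ∧ y 2 = shift (M.next a q).2.2 (y 1) := hb
      change (M.run p (y 0 + 1)).state = _ ∧ (M.run p (y 0 + 1)).head = y 2
      rw [run_succ, step_eq, hi, ha, hq, hd]
      exact ⟨rfl, rfl⟩
    | outBit b =>
      obtain ⟨⟨hq, -⟩, ha⟩ : ((M.run p (y 0)).state = M.accept ∧ (M.run p (y 0)).head = y 2) ∧
        (M.run p (y 0)).tape (y 1) = M.bit b := hb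
      rw [h.tape_eq hq, stringTape_eq_bit_iff] at ha
      obtain ⟨hi, hb⟩ := List.getElem?_eq_some_iff.1 ha
      exact .inl ⟨y 1, hi, congrArg (fun c : Bool => ![y 1, c.toNat]) hb.symm⟩
    | outEndZero b =>
      obtain ⟨⟨hq, -⟩, ha⟩ : ((M.run p (y 0)).state = M.accept ∧ (M.run p (y 0)).head = y 2) ∧
        (M.run p (y 0)).tape 0 = M.blank := hb
      rw [h.tape_eq hq, stringTape_eq_blank_iff] at ha
      exact end_mem_encodeString (Nat.le_zero.1 ha) b
    | outEnd b c =>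
      obtain ⟨⟨hq, -⟩, ha, hc⟩ : ((M.run p (y 0)).state = M.accept ∧
        (M.run p (y 0)).head = y 2) ∧ (M.run p (y 0)).tape (y 1 + 1) = M.blank ∧
        (M.run p (y 0)).tape (y 1) = M.bit c := hb
      rw [h.tape_eq hq, stringTape_eq_blank_iff] at ha
      rw [h.tape_eq hq, stringTape_eq_bit_iff] at hc
      have hlt := (List.getElem?_eq_some_iff.1 hc).1
      exact end_mem_encodeString (by omega) b

/-- Each fact of the intended interpretation is derived by a clause: the clauses are complete. -/
theorem runModel_supported {p σ : List Bool} (h : M.Outputs p σ) (v : RunRel M p.length)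
    (hv : v ≠ .unit) (x) (hx : x ∈ runModel M p σ v) :
    ∃ r y, (runClause M p r).BodyHolds (runModel M p σ) y ∧
      (⟨v, x⟩ : Σ v : RunRel M p.length, v.obj) =
        ⟨(runClause M p r).head, (runClause M p r).headMap y⟩ := by
  have tuple : ∀ x : Fin 2 → ℕ, ∃ t i, x = ![t, i] := fun x => ⟨x 0, x 1, by
    funext k; fin_cases k <;> rfl⟩
  have body : ∀ {r y}, (runClause M p r).body.Forall (fun a => a.2 y ∈ runModel M p σ a.1) →
      (runClause M p r).BodyHolds (runModel M p σ) y := List.forall_iff_forall_mem.1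
  cases v with
  | unit => exact (hv rfl).elim
  | pos i =>
    obtain rfl : x = (i : ℕ) := hx
    cases i using Fin.cases with
    | zero => exact ⟨.inr .posZero, ![0, 0, 0], body trivial, rfl⟩
    | succ i => exact ⟨.inl (.inl i), (i : ℕ), body rfl, rfl⟩
  | input b =>
    change ℕ at x
    obtain ⟨hi, rfl⟩ := List.getElem?_eq_some_iff.1 hx
    exact ⟨.inl (.inr ⟨x, hi⟩), x, body rfl, rfl⟩
  | tail =>
    obtain ⟨n, rfl⟩ := Nat.exists_eq_add_of_le (show p.length ≤ x from hx)
    cases n with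
    | zero => exact ⟨.inr .tailBase, ![p.length, 0, 0], body rfl, rfl⟩
    | succ n =>
      exact ⟨.inr .tailStep, ![p.length + n, 0, 0], body (Nat.le_add_right _ _), rfl⟩
  | ne =>
    obtain ⟨i, j, rfl⟩ := tuple x
    have hij : i ≠ j := hx
    rcases i with _ | i
    · obtain ⟨j, rfl⟩ := Nat.exists_eq_succ_of_ne_zero hij.symm
      exact ⟨.inr .neLeft, ![j, 0, 0], body trivial, rfl⟩
    · rcases j with _ | j
      · exact ⟨.inr .neRight, ![i, 0, 0], body trivial, rfl⟩
      · exact ⟨.inr .neStep, ![i, j, 0], body fun h => hij (congrArg Nat.succ h), rfl⟩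
  | move d =>
    obtain ⟨i, j, rfl⟩ := tuple x
    obtain rfl : j = shift d i := hx
    rcases d with _ | _ | _
    · exact ⟨.inr .moveStay, ![i, 0, 0], body trivial, rfl⟩
    · rcases i with _ | i
      · exact ⟨.inr .moveLeftZero, ![0, 0, 0], body trivial, rfl⟩
      · exact ⟨.inr .moveLeft, ![i, 0, 0], body trivial, rfl⟩
    · exact ⟨.inr .moveRight, ![i, 0, 0], body trivial, rfl⟩
  | head q =>
    obtain ⟨t, i, rfl⟩ := tuple x
    obtain ⟨hq, hi⟩ : (M.run p t).state = q ∧ (M.run p t).head = i := hx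
    cases t with
    | zero =>
      obtain rfl : M.start = q := hq
      obtain rfl : 0 = i := hi
      exact ⟨.inr .headStart, ![0, 0, 0], body trivial, rfl⟩
    | succ t =>
      rw [run_succ, step_eq] at hq hi
      dsimp only at hq hi
      subst hq
      exact ⟨.inr (.go (M.run p t).state ((M.run p t).tape (M.run p t).head)),
        ![t, (M.run p t).head, i], body ⟨⟨rfl, rfl⟩, rfl, hi.symm⟩, rfl⟩
  | cell a =>
    obtain ⟨t, i, rfl⟩ := tuple x
    have ha : (M.run p t).tape i = a := hx
    cases t with
    | zero =>
      change M.stringTape p i = a at ha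
      cases hpi : p[i]? with
      | none =>
        have hle : p.length ≤ i := by simpa using hpi
        rw [M.stringTape_eq_blank_iff.2 hle] at ha
        subst ha
        exact ⟨.inr .cellTail, ![0, i, 0], body hle, rfl⟩
      | some b =>
        rw [M.stringTape_eq_bit_iff.2 hpi] at ha
        subst ha
        exact ⟨.inr (.cellInput b), ![0, i, 0], body hpi, rfl⟩
    | succ t =>
      rw [run_succ, step_eq] at ha
      dsimp only at ha
      by_cases hi : i = (M.run p t).head
      · rw [hi, Function.update_self] at ha
        subst ha
        exact ⟨.inr (.write (M.run p t).state ((M.run p t).tape (M.run p t).head)),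
          ![t, i, 0], body ⟨⟨rfl, hi.symm⟩, congrArg _ hi⟩, rfl⟩
      · rw [Function.update_of_ne hi] at ha
        exact ⟨.inr (.keep (M.run p t).state a), ![t, i, (M.run p t).head],
          body ⟨⟨rfl, rfl⟩, ha, hi⟩, rfl⟩
  | out =>
    obtain ⟨t, ht, hσ⟩ := h
    change (M.run p t).state = M.accept at ht
    change (M.run p t).tape = M.stringTape σ at hσ
    -- The clause that finds the end of the output depends on whether the output is empty.
    have hend : ∀ b : Bool, ∃ r y, (runClause M p r).BodyHolds (runModel M p σ) y ∧
        (⟨.out, ![σ.length, b.toNat]⟩ : Σ v : RunRel M p.length, v.obj) =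
          ⟨(runClause M p r).head, (runClause M p r).headMap y⟩ := by
      intro b
      have hblank : (M.run p t).tape σ.length = M.blank := by
        rw [hσ, stringTape_eq_blank_iff]
      cases hn : σ.length with
      | zero =>
        rw [hn] at hblank
        exact ⟨.inr (.outEndZero b), ![t, 0, (M.run p t).head],
          body ⟨⟨ht, rfl⟩, hblank⟩, rfl⟩
      | succ n =>
        rw [hn] at hblank
        have hlt : n < σ.length := by omega
        have hbit : (M.run p t).tape n = M.bit σ[n] := by
          rw [hσ, stringTape_eq_bit_iff, List.getElem?_eq_getElem hlt]
        exact ⟨.inr (.outEnd b σ[n]), ![t, n, (M.run p t).head],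
          body ⟨⟨ht, rfl⟩, hblank, hbit⟩, rfl⟩
    rcases hx with ⟨i, hi, rfl⟩ | rfl | rfl
    · have hbit : (M.run p t).tape i = M.bit σ[i] := by
        rw [hσ, stringTape_eq_bit_iff, List.getElem?_eq_getElem hi]
      exact ⟨.inr (.outBit σ[i]), ![t, i, (M.run p t).head], body ⟨⟨ht, rfl⟩, hbit⟩, rfl⟩
    · exact hend false
    · exact hend true

/-- The output of a machine `M` on input `p` has structural information at most `4 |p|`, up to a
constant that depends only on `M`. -/
theorem structuralInformation_encodeString_le {p σ : List Bool} (h : M.Outputs p σ) :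
    structuralInformation (encodeString σ) natStructureMaps ≤
      4 * (p.length : ℕ∞) + (44 * Nat.card (RunRule M) : ℕ) := by
  have := Fintype.ofFinite (RunRule M)
  have hm : HornClause.IsSupportedModel .unit (runClause M p) (runModel M p σ) :=
    ⟨runModel_closed h, runModel_supported h⟩
  refine (HornClause.structuralInformation_le natStructureMaps (o := RunRel.unit) rfl
    (runClause M p) ?_ (runClause_body_ne_nil p) (exists_runClause_head_eq_iff p) hm rfl
    (fun s hs ho => hs.eq runRank (runRank_lt p) hm ho) .out).trans ?_
  · rintro ((i | i) | r)
    · exact ⟨NatSizeLE.natSucc.generated, List.forall_mem_singleton.2 NatSizeLE.id.generated⟩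
    · exact ⟨NatSizeLE.id.generated, List.forall_mem_singleton.2 NatSizeLE.id.generated⟩
    · exact ⟨(natSizeLE_clause _ r).1.generated,
        fun a ha => ((natSizeLE_clause _ r).2 a ha).generated⟩
  · rw [Fintype.sum_sum_type, Fintype.sum_sum_type]
    have h1 : ∀ i, (runClause M p (.inl (.inl i))).cost natStructureMaps ≤ 2 := fun i =>
      (add_le_add NatSizeLE.natSucc.genSize_le
        ((Fin.sum_univ_one _).trans_le NatSizeLE.id.genSize_le)).trans (by norm_num)
    have h2 : ∀ i, (runClause M p (.inl (.inr i))).cost natStructureMaps ≤ 2 := fun i =>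
      (add_le_add NatSizeLE.id.genSize_le
        ((Fin.sum_univ_one _).trans_le NatSizeLE.id.genSize_le)).trans (by norm_num)
    refine (add_le_add (add_le_add (Finset.sum_le_sum fun i _ => h1 i)
      (Finset.sum_le_sum fun i _ => h2 i))
      (Finset.sum_le_sum fun r _ => cost_clause_le p.length r)).trans (le_of_eq ?_)
    simp only [Finset.sum_const, Finset.card_univ, Fintype.card_fin, nsmul_eq_mul,
      Nat.card_eq_fintype_card]
    push_cast
    ring

end TuringMachine

theorem mainTheorem1 (U : TuringMachine) (hU : U.IsUniversal) :
    ∃ c : ℕ, ∀ σ : List Bool,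
      structuralInformation (encodeString σ) natStructureMaps ≤
        6 * U.kolmogorovComplexity σ + (c : ℕ∞) := by
  refine ⟨44 * Nat.card (TuringMachine.RunRule U), fun σ => ?_⟩
  by_cases hK : ∃ p, U.Outputs p σ
  · obtain ⟨p, hp, hle⟩ : ∃ p, U.Outputs p σ ∧ (p.length : ℕ∞) ≤ U.kolmogorovComplexity σ := by
      classical
      obtain ⟨p₀, hp₀⟩ := hK
      have hex : ∃ n p, U.Outputs p σ ∧ p.length = n := ⟨_, p₀, hp₀, rfl⟩
      obtain ⟨p, hp, hpn⟩ := Nat.find_spec hex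
      refine ⟨p, hp, le_iInf₂ fun q hq => ?_⟩
      rw [hpn]
      exact_mod_cast Nat.find_min' hex ⟨q, hq, rfl⟩
    refine (TuringMachine.structuralInformation_encodeString_le hp).trans ?_
    gcongr
    norm_num
  · -- If `σ` is not an output of `U`, the bound is `⊤`.
    have : U.kolmogorovComplexity σ = ⊤ := by
      simp only [TuringMachine.kolmogorovComplexity, iInf_eq_top]
      exact fun p hp => (hK ⟨p, hp⟩).elim
    rw [this, ENat.mul_top (by norm_num), top_add]
    exact le_top
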